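/- Let $X=(X,d,\mu)$ be a metric space with a complete Borel measure $\mu$ such that $0<\mu(B)<\infty$ for all balls $B$, let $x_0\in X$ and $B_r=B(x_0,r)=\{x:d(x,x_0)<r\}$. Definitions. Curves are nonconstant, compact and rectifiable, parametrized by arc length $ds$. A Borel function $g:X\to[0,\infty]$ is an upper gradient of $f$ if $|f(\gamma(0))-f(\gamma(l_\gamma))|\le\int_\gamma g\,ds$ for all curves $\gamma:[0,l_\gamma]\to X$; a measurable $g$ is a $p$-weak upper gradient of $f$ if this holds except for a family of curves $\Gamma$ for which there is $0\le\rho\in L^p(X)$ with $\int_\gamma\rho\,ds=\infty$ for all $\gamma\in\Gamma$; $g_u$ is the minimal $p$-weak upper gradient of $u$. $N^{1,p}(X)$ is the set of (everywhere defined) measurable $f\in L^p(X)$ that have an upper gradient in $L^p(X)$. For $\Omega$ open and $E\subset\Omega$, $\mathrm{cap}_p(E,\Omega)=\inf_u\int_\Omega g_u^p\,d\mu$, the infimum being over all $u\in N^{1,p}(X)$ with $\chi_E\le u\le1$ in $\Omega$ and $u=0$ on $X\setminus\Omega$. The measure $\mu$ is doubling at $x$ if $\mu(B(x,2r))\le C\mu(B(x,r))$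 for all $r>0$, and globally doubling if this holds for all $x$ with the same $C$; it is reverse-doubling at $x$, with dilation $\tau>1$, if there is $\kappa>1$ such that $\mu(B(x,\tau r))\ge\kappa\mu(B(x,r))$ for $0<r\le\operatorname{diam}X/(2\tau)$. $X$ supports a $p$-Poincaré inequality at $x$ if there are $C>0$ and $\lambda\ge1$ such that for all $r>0$, all integrable $f$ on $X$ and all upper gradients $g$ of $f$, with $B=B(x,r)$ and $f_B$ the mean value of $f$ over $B$, $$\frac1{\mu(B)}\int_B|f-f_B|\,d\mu\le Cr\Bigl(\frac1{\mu(B(x,\lambda r))}\int_{B(x,\lambda r)}g^p\,d\mu\Bigr)^{1/p},$$ and a global $p$-Poincaré inequality if this holds for all $x$ with the same $C,\lambda$. Corollary. Let $1\le q<p<\infty$. Assume that $\mu$ is globally doubling, that $X$ supports a global $p$-Poincaré inequality and that $X$ supports a $q$-Poincaré inequality at $x_0$. Let $a>0$ and $\tau>1$. Then $$\mathrm{cap}_p(B_r,B_R)\ge c\Bigl(1-\frac rR\Bigr)^{q-p}\frac{\mu(B_R)}{R^p}$$ for all $r,R$ with $0<\frac R2\le r<R<\frac{\operatorname{diam}X}{2\tau}$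 that satisfy the following condition with $\delta=R-r$: for every $x\in B_R\setminus B_r$ there are $x',x''\in X$ such that $B(x',a\delta)\subset B(x,2\delta)\cap B_r$ and $B(x'',a\delta)\subset B(x,2\delta)\setminus B_R$. Here $c>0$ depends only on $p$, $q$, $a$, $\tau$ and the constants in the doubling condition and in the two Poincaré inequalities. Lemma. Let $1\le q<\infty$. Assume that $X$ supports a $q$-Poincaré inequality at $x_0$ and that $\mu$ is doubling at $x_0$ and reverse-doubling at $x_0$ with dilation $\tau>1$. Then $$\mu(B_R\setminus B_r)\ge c\Bigl(1-\frac rR\Bigr)^q\mu(B_R)\quad\text{whenever } 0<\frac R2\le r<R<\frac{\operatorname{diam}X}{2\tau},$$ where $c>0$ depends only on $q$ and the constants in the doubling, reverse-doubling and Poincaré assumptions. -/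

import Mathlib

open MeasureTheory Set
open scoped ENNReal

namespace AnnularCap

/-- A nonconstant compact rectifiable curve, parametrized by arc length on `[0, len]`.
The values of `toFun` outside `[0, len]` play no role. -/
structure Curve (X : Type*) [MetricSpace X] where
  len : ℝ
  len_pos : 0 < len
  toFun : ℝ → X
  unitSpeed : HasUnitSpeedOn toFun (Icc 0 len)

section UpperGradients

variable {X : Type*} [MetricSpace X]

/-- The line integral `∫_γ g ds`. -/
noncomputable def lineIntegral (γ : Curve X) (g : X → ℝ≥0∞) : ℝ≥0∞ :=
  ∫⁻ t in Icc 0 γ.len, g (γ.toFun t)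

/-- The upper gradient inequality for the pair `(f, g)` along the curve `γ`. -/
def UpperGradientIneq (f : X → ℝ) (g : X → ℝ≥0∞) (γ : Curve X) : Prop :=
  ENNReal.ofReal |f (γ.toFun 0) - f (γ.toFun γ.len)| ≤ lineIntegral γ g

variable [MeasurableSpace X]

/-- The Borel function `g` is an upper gradient of `f`. -/
def IsUpperGradient (f : X → ℝ) (g : X → ℝ≥0∞) : Prop :=
  Measurable g ∧ ∀ γ : Curve X, UpperGradientIneq f g γ

/-- The curve family `Γ` has zero `p`-modulus: some nonnegative `ρ ∈ L^p(X)` has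
infinite line integral along every curve of `Γ`. -/
def ZeroModulus (p : ℝ) (μ : Measure X) (Γ : Set (Curve X)) : Prop :=
  ∃ ρ : X → ℝ≥0∞, Measurable ρ ∧ ∫⁻ x, ρ x ^ p ∂μ < ∞ ∧ ∀ γ ∈ Γ, lineIntegral γ ρ = ∞

/-- `g` is a `p`-weak upper gradient of `f`. Measurability refers to the completion of `μ`. -/
def IsWeakUpperGradient (p : ℝ) (μ : Measure X) (f : X → ℝ) (g : X → ℝ≥0∞) : Prop :=
  AEMeasurable g μ ∧ ZeroModulus p μ {γ | ¬ UpperGradientIneq f g γ}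

/-- `g` is a minimal `p`-weak upper gradient of `f`: it lies in `L^p(X)` and is a.e. below every
`p`-weak upper gradient of `f` in `L^p(X)`. -/
def IsMinimalWeakUpperGradient (p : ℝ) (μ : Measure X) (f : X → ℝ) (g : X → ℝ≥0∞) : Prop :=
  IsWeakUpperGradient p μ f g ∧ ∫⁻ x, g x ^ p ∂μ < ∞ ∧
    ∀ h : X → ℝ≥0∞, IsWeakUpperGradient p μ f h → ∫⁻ x, h x ^ p ∂μ < ∞ → g ≤ᵐ[μ] h

/-- The Newtonian norm `(∫ |f|^p dμ + inf_g ∫ g^p dμ)^{1/p}`, the infimum being over all upper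
gradients `g` of `f`. -/
noncomputable def newtonianNorm (p : ℝ) (μ : Measure X) (f : X → ℝ) : ℝ≥0∞ :=
  (∫⁻ x, ENNReal.ofReal |f x| ^ p ∂μ +
    ⨅ (g : X → ℝ≥0∞) (_ : IsUpperGradient f g), ∫⁻ x, g x ^ p ∂μ) ^ (1 / p)

/-- Membership of the everywhere defined function `f` in the Newtonian space `N^{1,p}(X)`. -/
def MemNewtonian (p : ℝ) (μ : Measure X) (f : X → ℝ) : Prop :=
  AEMeasurable f μ ∧ newtonianNorm p μ f < ∞

/-- The energy `∫_Ω g_u^p dμ` of the minimal `p`-weak upper gradient `g_u` of `u`, written as the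
infimum over all `p`-weak upper gradients of `u` in `L^p(X)`; since `g_u` is a.e. the least of
them, the two agree, see `energy_eq_of_isMinimal`. -/
noncomputable def energy (p : ℝ) (μ : Measure X) (u : X → ℝ) (Ω : Set X) : ℝ≥0∞ :=
  ⨅ (g : X → ℝ≥0∞) (_ : IsWeakUpperGradient p μ u g ∧ ∫⁻ x, g x ^ p ∂μ < ∞),
    ∫⁻ x in Ω, g x ^ p ∂μ

theorem energy_eq_of_isMinimal {p : ℝ} (hp : 0 ≤ p) {μ : Measure X} {u : X → ℝ} {g : X → ℝ≥0∞}
    (hg : IsMinimalWeakUpperGradient p μ u g) (Ω : Set X) :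
    energy p μ u Ω = ∫⁻ x in Ω, g x ^ p ∂μ := by
  refine le_antisymm (iInf₂_le g ⟨hg.1, hg.2.1⟩) (le_iInf₂ fun h hh => ?_)
  refine lintegral_mono_ae (ae_restrict_of_ae ?_)
  filter_upwards [hg.2.2 h hh.1 hh.2] with x hx
  exact ENNReal.rpow_le_rpow hx hp

/-- The admissible functions for the variational capacity `cap_p(E, Ω)`. -/
def IsAdmissible (p : ℝ) (μ : Measure X) (E Ω : Set X) (u : X → ℝ) : Prop :=
  MemNewtonian p μ u ∧ (∀ x ∈ Ω, E.indicator 1 x ≤ u x ∧ u x ≤ 1) ∧ ∀ x ∉ Ω, u x = 0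

/-- The variational `p`-capacity `cap_p(E, Ω)` of `E ⊆ Ω` with respect to the open set `Ω`. -/
noncomputable def variationalCapacity (p : ℝ) (μ : Measure X) (E Ω : Set X) : ℝ≥0∞ :=
  ⨅ (u : X → ℝ) (_ : IsAdmissible p μ E Ω u), energy p μ u Ω

/-- `μ` is doubling at `x` with constant `C`. -/
def DoublingAt (μ : Measure X) (x : X) (C : ℝ) : Prop :=
  ∀ r : ℝ, 0 < r → μ (Metric.ball x (2 * r)) ≤ ENNReal.ofReal C * μ (Metric.ball x r)

/-- `μ` is reverse-doubling at `x` with constants `κ` and `τ`: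
`μ(B(x, τ r)) ≥ κ μ(B(x, r))` for `0 < r ≤ diam X / (2 τ)`. -/
def ReverseDoublingAt (μ : Measure X) (x : X) (κ τ : ℝ) : Prop :=
  ∀ r : ℝ, 0 < r → ENNReal.ofReal (2 * τ * r) ≤ Metric.ediam (univ : Set X) →
    ENNReal.ofReal κ * μ (Metric.ball x r) ≤ μ (Metric.ball x (τ * r))

/-- The `q`-Poincaré inequality at `x` with constant `C` and dilation `lam`. -/
def PoincareAt (q : ℝ) (μ : Measure X) (x : X) (C lam : ℝ) : Prop :=
  ∀ r : ℝ, 0 < r → ∀ (f : X → ℝ) (g : X → ℝ≥0∞), Integrable f μ → IsUpperGradient f g →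
    ENNReal.ofReal (⨍ y in Metric.ball x r, |f y - ⨍ z in Metric.ball x r, f z ∂μ| ∂μ) ≤
      ENNReal.ofReal (C * r) * (⨍⁻ y in Metric.ball x (lam * r), g y ^ q ∂μ) ^ (1 / q)

/-- The geometric condition on the annulus `B(x₀, R) \ B(x₀, r)`, with `δ = R - r`. -/
def AnnulusCondition (x₀ : X) (a r R : ℝ) : Prop :=
  ∀ x ∈ Metric.ball x₀ R \ Metric.ball x₀ r, ∃ x' x'' : X,
    Metric.ball x' (a * (R - r)) ⊆ Metric.ball x (2 * (R - r)) ∩ Metric.ball x₀ r ∧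
    Metric.ball x'' (a * (R - r)) ⊆ Metric.ball x (2 * (R - r)) \ Metric.ball x₀ R

end UpperGradients

end AnnularCap

/-! Write δ = R - r. Everything rests on one estimate, `PoincareAt.measure_ball_mul_le`: if f equals
1 and 0 on two parts of B(x, s), each of relative measure at least θ, then the mean oscillation of f
on B(x, s) is at least θ/2, so the Poincaré inequality bounds the energy of every upper gradient
from below.

Lemma: test the q-inequality on B(x₀, τR) with the radial cutoff, whose upper gradient is 1/δ on the
annulus and 0 elsewhere. It is 1 on B_r (large by doubling) and 0 on B_{τR} \ B_R (large by reverse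
doubling), so μ(B_R \ B_r) ≥ c(δ/R)^q μ(B_R): `PoincareAt.le_measure_annulus`.

Corollary: for admissible u, apply the p-inequality on balls B(x, 2δ) centred in the annulus; the
geometric condition supplies the two parts. A Vitali covering sums these bounds to μ(B_R \ B_r) ≤
Cδ^p ∫ g^p (`measure_annulus_le`), and the lemma's bound finishes. Reverse doubling, not assumed
here, is replaced by `PoincareAt.le_measure_diff`. Since the capacity uses weak upper gradients and
integrates only over B_R, `IsWeakUpperGradient.exists_isUpperGradient` passes to genuine upper
gradients at cost ε. -/

namespace AnnularCap

/-! ### Subcurves and truncation of upper gradients to an open set. -/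

section Curves

variable {X : Type*} [MetricSpace X]

theorem Curve.lipschitzOnWith (γ : Curve X) : LipschitzOnWith 1 γ.toFun (Icc 0 γ.len) := by
  have key : ∀ x ∈ Icc 0 γ.len, ∀ y ∈ Icc 0 γ.len, x ≤ y →
      edist (γ.toFun x) (γ.toFun y) ≤ edist x y := by
    intro x hx y hy hxy
    have h := γ.unitSpeed hx hy
    have h2 := eVariationOn.edist_le γ.toFun (s := Icc 0 γ.len ∩ Icc x y)
      ⟨hx, left_mem_Icc.2 hxy⟩ ⟨hy, right_mem_Icc.2 hxy⟩
    rw [h] at h2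
    rw [edist_comm x y, edist_dist y x, Real.dist_eq, abs_of_nonneg (sub_nonneg.2 hxy)]
    simpa using h2
  intro x hx y hy
  rw [ENNReal.coe_one, one_mul]
  rcases le_total x y with h | h
  · exact key x hx y hy h
  · rw [edist_comm (γ.toFun x), edist_comm x]
    exact key y hy x hx h

/-- The restriction of a curve to `[a, b]`, reparametrized to start at time `0`. -/
def Curve.sub (γ : Curve X) (a b : ℝ) (ha : 0 ≤ a) (hab : a < b) (hb : b ≤ γ.len) : Curve X where
  len := b - a
  len_pos := sub_pos.2 hab
  toFun := γ.toFun ∘ fun t => t + a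
  unitSpeed := by
    intro x hx y hy
    rw [eVariationOn.comp_eq_of_monotoneOn _ _ fun s _ t _ hst => by simpa using hst]
    have hx' : x + a ∈ Icc 0 γ.len := ⟨by linarith [hx.1], by linarith [hx.2]⟩
    have hy' : y + a ∈ Icc 0 γ.len := ⟨by linarith [hy.1], by linarith [hy.2]⟩
    have h := γ.unitSpeed hx' hy'
    rw [add_sub_add_right_eq_sub] at h
    rw [← h]
    congr 1
    rw [inter_eq_right.2 (Icc_subset_Icc hx.1 hy.2), image_add_const_Icc,
      inter_eq_right.2 (Icc_subset_Icc hx'.1 hy'.2)]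

theorem Curve.lineIntegral_sub (γ : Curve X) {a b : ℝ} (ha : 0 ≤ a) (hab : a < b)
    (hb : b ≤ γ.len) (g : X → ℝ≥0∞) :
    lineIntegral (γ.sub a b ha hab hb) g = ∫⁻ t in Icc a b, g (γ.toFun t) := by
  have h := (measurePreserving_add_right (volume : Measure ℝ) a).setLIntegral_comp_preimage_emb
    (measurableEmbedding_addRight a) (fun t => g (γ.toFun t)) (Icc a b)
  rw [preimage_add_const_Icc, sub_self] at h
  exact h

theorem Curve.lineIntegral_sub_le (γ : Curve X) {a b : ℝ} (ha : 0 ≤ a) (hab : a < b)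
    (hb : b ≤ γ.len) (g : X → ℝ≥0∞) :
    lineIntegral (γ.sub a b ha hab hb) g ≤ lineIntegral γ g := by
  rw [Curve.lineIntegral_sub]
  exact lintegral_mono_set (Icc_subset_Icc ha hb)

theorem Curve.ofReal_abs_sub_le (γ : Curve X) {a b : ℝ} (ha : 0 ≤ a) (hab : a < b)
    (hb : b ≤ γ.len) {u : X → ℝ} {g : X → ℝ≥0∞}
    (h : UpperGradientIneq u g (γ.sub a b ha hab hb)) :
    ENNReal.ofReal |u (γ.toFun a) - u (γ.toFun b)| ≤ ∫⁻ t in Icc a b, g (γ.toFun t) := by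
  rw [← γ.lineIntegral_sub ha hab hb]
  simpa [UpperGradientIneq, Curve.sub] using h

/-- If `u` vanishes off the open set `Ω` and satisfies the upper gradient inequality on every
subcurve of `γ`, then only the part of `g` in `Ω` matters. -/
theorem UpperGradientIneq.indicator {u : X → ℝ} {g : X → ℝ≥0∞} {Ω : Set X} (hΩ : IsOpen Ω)
    (hu : ∀ x ∉ Ω, u x = 0) (γ : Curve X)
    (h : ∀ a b (ha : 0 ≤ a) (hab : a < b) (hb : b ≤ γ.len),
      UpperGradientIneq u g (γ.sub a b ha hab hb)) :
    UpperGradientIneq u (Ω.indicator g) γ := by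
  have hl := γ.len_pos
  have P : ∀ a b, 0 ≤ a → a < b → b ≤ γ.len →
      ENNReal.ofReal |u (γ.toFun a) - u (γ.toFun b)| ≤ ∫⁻ t in Icc a b, g (γ.toFun t) :=
    fun a b ha hab hb => γ.ofReal_abs_sub_le ha hab hb (h a b ha hab hb)
  have hcont : ContinuousOn γ.toFun (Icc 0 γ.len) := γ.lipschitzOnWith.continuousOn
  unfold UpperGradientIneq lineIntegral
  set S := Icc 0 γ.len ∩ γ.toFun ⁻¹' Ωᶜ with hS
  have hSc : IsCompact S :=
    isCompact_Icc.of_isClosed_subset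
      (hcont.preimage_isClosed_of_isClosed isClosed_Icc hΩ.isClosed_compl) inter_subset_left
  rcases S.eq_empty_or_nonempty with hSe | hSne
  · have hin : ∀ t ∈ Icc 0 γ.len, γ.toFun t ∈ Ω := fun t ht => by
      by_contra hc
      exact (hSe ▸ (⟨ht, hc⟩ : t ∈ S) : t ∈ (∅ : Set ℝ))
    refine (P 0 γ.len le_rfl hl le_rfl).trans_eq (setLIntegral_congr_fun measurableSet_Icc ?_)
    intro t ht
    exact (indicator_of_mem (hin t ht) g).symm
  -- `a` and `b` are the first and last times outside `Ω`. As `u` vanishes at both, what happens in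
  -- between is irrelevant, and before `a` and after `b` the curve stays in `Ω`.
  obtain ⟨a, haS, ha⟩ := hSc.exists_isLeast hSne
  obtain ⟨b, hbS, hb⟩ := hSc.exists_isGreatest hSne
  have hab : a ≤ b := ha hbS
  have hua : u (γ.toFun a) = 0 := hu _ haS.2
  have hub : u (γ.toFun b) = 0 := hu _ hbS.2
  have h1 : ENNReal.ofReal |u (γ.toFun 0)| ≤ ∫⁻ t in Ico 0 a, Ω.indicator g (γ.toFun t) := by
    rcases haS.1.1.eq_or_lt with h0 | h0
    · rw [h0, hua]; simp
    · have := P 0 a le_rfl h0 haS.1.2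
      rw [hua, sub_zero, setLIntegral_congr Ico_ae_eq_Icc.symm] at this
      refine this.trans_eq (setLIntegral_congr_fun measurableSet_Ico fun t ht => ?_)
      refine (indicator_of_mem ?_ g).symm
      by_contra hc
      exact absurd (ha ⟨⟨ht.1, ht.2.le.trans haS.1.2⟩, hc⟩) (not_le.2 ht.2)
  have h2 : ENNReal.ofReal |u (γ.toFun γ.len)| ≤
      ∫⁻ t in Ioc b γ.len, Ω.indicator g (γ.toFun t) := by
    rcases hbS.1.2.eq_or_lt with h0 | h0
    · rw [← h0, hub]; simp
    · have := P b γ.len hbS.1.1 h0 le_rfl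
      rw [hub, zero_sub, abs_neg, setLIntegral_congr Ioc_ae_eq_Icc.symm] at this
      refine this.trans_eq (setLIntegral_congr_fun measurableSet_Ioc fun t ht => ?_)
      refine (indicator_of_mem ?_ g).symm
      by_contra hc
      exact absurd (hb ⟨⟨hbS.1.1.trans ht.1.le, ht.2⟩, hc⟩) (not_le.2 ht.1)
  calc ENNReal.ofReal |u (γ.toFun 0) - u (γ.toFun γ.len)|
      ≤ ENNReal.ofReal (|u (γ.toFun 0)| + |u (γ.toFun γ.len)|) :=
        ENNReal.ofReal_le_ofReal (abs_sub _ _)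
    _ = ENNReal.ofReal |u (γ.toFun 0)| + ENNReal.ofReal |u (γ.toFun γ.len)| :=
        ENNReal.ofReal_add (abs_nonneg _) (abs_nonneg _)
    _ ≤ _ := add_le_add h1 h2
    _ = ∫⁻ t in Ico 0 a ∪ Ioc b γ.len, Ω.indicator g (γ.toFun t) := by
        rw [lintegral_union measurableSet_Ioc]
        rw [Set.disjoint_left]
        intro t ht ht'
        linarith [ht.2, ht'.1]
    _ ≤ _ := by
        refine lintegral_mono_set (union_subset ?_ ?_)
        · exact fun t ht => ⟨ht.1, ht.2.le.trans haS.1.2⟩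
        · exact fun t ht => ⟨hbS.1.1.trans ht.1.le, ht.2⟩

end Curves

/-! ### The radial cutoff function and its upper gradient. -/

section Cutoff

variable {X : Type*} [MetricSpace X]

/-- The function that is `1` on `B(x₀, r)`, vanishes off `B(x₀, R)` and is linear in the distance
to `x₀` in between. -/
noncomputable def cutoff (x₀ : X) (r R : ℝ) (x : X) : ℝ :=
  max 0 (min 1 ((R - dist x x₀) / (R - r)))

theorem cutoff_nonneg (x₀ : X) (r R : ℝ) (x : X) : 0 ≤ cutoff x₀ r R x := le_max_left _ _

theorem cutoff_le_one (x₀ : X) (r R : ℝ) (x : X) : cutoff x₀ r R x ≤ 1 :=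
  max_le zero_le_one (min_le_left _ _)

theorem cutoff_eq_one {x₀ x : X} {r R : ℝ} (hrR : r < R) (hx : x ∈ Metric.ball x₀ r) :
    cutoff x₀ r R x = 1 := by
  have h : 1 ≤ (R - dist x x₀) / (R - r) := by
    rw [one_le_div (sub_pos.2 hrR)]
    linarith [Metric.mem_ball.1 hx]
  rw [cutoff, min_eq_left h, max_eq_right zero_le_one]

theorem cutoff_eq_zero {x₀ x : X} {r R : ℝ} (hrR : r < R) (hx : x ∉ Metric.ball x₀ R) :
    cutoff x₀ r R x = 0 := by
  have h : (R - dist x x₀) / (R - r) ≤ 0 :=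
    div_nonpos_of_nonpos_of_nonneg (by linarith [not_lt.1 (mt Metric.mem_ball.2 hx)])
      (sub_pos.2 hrR).le
  rw [cutoff, max_eq_left ((min_le_right _ _).trans h)]

theorem cutoff_lipschitzWith (x₀ : X) {r R : ℝ} (hrR : r < R) :
    LipschitzWith (Real.toNNReal (1 / (R - r))) (cutoff x₀ r R) := by
  have h0 := sub_pos.2 hrR
  have : LipschitzWith (Real.toNNReal (1 / (R - r))) fun x => (R - dist x x₀) / (R - r) := by
    refine LipschitzWith.of_dist_le_mul fun x y => ?_
    rw [Real.coe_toNNReal _ (by positivity), Real.dist_eq, ← sub_div, abs_div, abs_of_pos h0,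
      one_div, inv_mul_eq_div]
    gcongr
    rw [sub_sub_sub_cancel_left, abs_sub_comm]
    exact abs_dist_sub_le x y x₀
  exact (this.const_min 1).const_max 0

variable [MeasurableSpace X] [BorelSpace X]

/-- Along a curve, the cutoff takes values in (0, 1) only at times `A` spent in the annulus. By the
intermediate value theorem the image of `A` covers the open interval between the end values, and a
Lipschitz map with constant 1/(R - r) stretches length by at most that factor; no differentiation is
needed. -/
theorem isUpperGradient_cutoff (x₀ : X) {r R : ℝ} (hrR : r < R) :
    IsUpperGradient (cutoff x₀ r R) ((Metric.ball x₀ R \ Metric.ball x₀ r).indicator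
      fun _ => ENNReal.ofReal (1 / (R - r))) := by
  refine ⟨measurable_const.indicator (measurableSet_ball.diff measurableSet_ball), fun γ => ?_⟩
  set K := Real.toNNReal (1 / (R - r))
  set h : ℝ → ℝ := cutoff x₀ r R ∘ γ.toFun
  have hlip : LipschitzOnWith K h (Icc 0 γ.len) := by
    have := (cutoff_lipschitzWith x₀ hrR).comp_lipschitzOnWith γ.lipschitzOnWith
    rwa [mul_one] at this
  obtain ⟨U, hU, hUeq⟩ := continuousOn_iff'.1 hlip.continuousOn (Ioo 0 1) isOpen_Ioo
  set A := h ⁻¹' Ioo 0 1 ∩ Icc 0 γ.len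
  have hA : MeasurableSet A := by
    rw [show A = _ from hUeq]
    exact hU.measurableSet.inter measurableSet_Icc
  have hAmem : ∀ t ∈ A, γ.toFun t ∈ Metric.ball x₀ R \ Metric.ball x₀ r := by
    intro t ht
    constructor
    · by_contra hc
      exact ht.1.1.ne' (cutoff_eq_zero hrR hc)
    · intro hc
      exact ht.1.2.ne (cutoff_eq_one hrR hc)
  have hsub : Ioo (min (h 0) (h γ.len)) (max (h 0) (h γ.len)) ⊆ h '' A := by
    intro v hv
    have hl := γ.len_pos.le
    obtain ⟨t, ht, rfl⟩ := intermediate_value_uIcc (f := h) (a := 0) (b := γ.len)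
      (by rw [uIcc_of_le hl]; exact hlip.continuousOn) (Ioo_subset_Icc_self hv)
    rw [uIcc_of_le hl] at ht
    refine ⟨t, ⟨⟨lt_of_le_of_lt ?_ hv.1, lt_of_lt_of_le hv.2 ?_⟩, ht⟩, rfl⟩
    · exact le_min (cutoff_nonneg _ _ _ _) (cutoff_nonneg _ _ _ _)
    · exact max_le (cutoff_le_one _ _ _ _) (cutoff_le_one _ _ _ _)
  have himg := (hlip.mono (inter_subset_right : A ⊆ _)).hausdorffMeasure_image_le zero_le_one
  rw [hausdorffMeasure_real, ENNReal.rpow_one] at himg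
  calc ENNReal.ofReal |h 0 - h γ.len|
      = volume (Ioo (min (h 0) (h γ.len)) (max (h 0) (h γ.len))) := by
        rw [Real.volume_Ioo, max_sub_min_eq_abs']
    _ ≤ volume (h '' A) := measure_mono hsub
    _ ≤ ENNReal.ofReal (1 / (R - r)) * volume A := himg
    _ = ∫⁻ t in A, ENNReal.ofReal (1 / (R - r)) := by rw [setLIntegral_const]
    _ = ∫⁻ t in A, (Metric.ball x₀ R \ Metric.ball x₀ r).indicator
          (fun _ => ENNReal.ofReal (1 / (R - r))) (γ.toFun t) :=
        setLIntegral_congr_fun hA fun t ht => by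
          simp only [indicator_of_mem (hAmem t ht)]
    _ ≤ _ := lintegral_mono_set inter_subset_right

end Cutoff

/-! ### Energy lower bound from a Poincaré inequality. -/

section Oscillation

/-- Every real `m` is at distance at least 1/2 from 1 or from 0, so `f` deviates from `m` by 1/2 on
all of `A` or on all of `D`. -/
theorem le_two_mul_lintegral_abs_sub {X : Type*} [MeasurableSpace X] {μ : Measure X} {B A D : Set X}
    {f : X → ℝ} {M : ℝ≥0∞} (m : ℝ)
    (hA : MeasurableSet A) (hD : MeasurableSet D) (hAB : A ⊆ B) (hDB : D ⊆ B)
    (hfA : ∀ x ∈ A, f x = 1) (hfD : ∀ x ∈ D, f x = 0) (hMA : M ≤ μ A) (hMD : M ≤ μ D) :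
    M ≤ 2 * ∫⁻ x in B, ENNReal.ofReal |f x - m| ∂μ := by
  have key : ∀ E : Set X, MeasurableSet E → E ⊆ B → M ≤ μ E →
      (∀ x ∈ E, 1 / 2 ≤ |f x - m|) → M ≤ 2 * ∫⁻ x in B, ENNReal.ofReal |f x - m| ∂μ := by
    intro E hE hEB hME hf
    have h2 : (2 : ℝ≥0∞) * ENNReal.ofReal (1 / 2) = 1 := by
      rw [one_div, ENNReal.ofReal_inv_of_pos two_pos, ENNReal.ofReal_ofNat]
      exact ENNReal.mul_inv_cancel two_ne_zero ENNReal.ofNat_ne_top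
    calc M ≤ 2 * (ENNReal.ofReal (1 / 2) * μ E) := by rw [← mul_assoc, h2, one_mul]; exact hME
      _ = 2 * ∫⁻ x in E, ENNReal.ofReal (1 / 2) ∂μ := by rw [setLIntegral_const]
      _ ≤ 2 * ∫⁻ x in E, ENNReal.ofReal |f x - m| ∂μ := by
        gcongr 2 * ?_
        exact setLIntegral_mono' hE fun x hx => ENNReal.ofReal_le_ofReal (hf x hx)
      _ ≤ _ := by
        gcongr 2 * ?_
        exact lintegral_mono_set hEB
  rcases le_total m (1 / 2) with hm | hm
  · refine key A hA hAB hMA fun x hx => ?_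
    rw [hfA x hx]
    exact le_trans (by linarith) (le_abs_self _)
  · refine key D hD hDB hMD fun x hx => ?_
    rw [hfD x hx]
    exact le_trans (by linarith) (neg_le_abs _)

variable {X : Type*} [MetricSpace X] [MeasurableSpace X] {μ : Measure X}

/-- Lower bound for the energy of a function that takes the values `1` and `0` on large portions
of a ball where a Poincaré inequality holds. -/
theorem PoincareAt.measure_ball_mul_le {q C lam s θ : ℝ} {x : X} (h : PoincareAt q μ x C lam)
    (hμ : ∀ (y : X) (r : ℝ), 0 < r → 0 < μ (Metric.ball y r) ∧ μ (Metric.ball y r) < ∞)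
    (hq : 1 ≤ q) (hlam : 1 ≤ lam) (hC : 0 < C) (hs : 0 < s) (hθ : 0 < θ)
    {f : X → ℝ} {g : X → ℝ≥0∞} {A D : Set X}
    (hf : Integrable f μ) (hg : IsUpperGradient f g) (hA : MeasurableSet A) (hD : MeasurableSet D)
    (hAB : A ⊆ Metric.ball x s) (hDB : D ⊆ Metric.ball x s)
    (hfA : ∀ y ∈ A, f y = 1) (hfD : ∀ y ∈ D, f y = 0)
    (hMA : ENNReal.ofReal θ * μ (Metric.ball x s) ≤ μ A)
    (hMD : ENNReal.ofReal θ * μ (Metric.ball x s) ≤ μ D) :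
    ENNReal.ofReal (θ ^ q) * μ (Metric.ball x (lam * s)) ≤
      ENNReal.ofReal ((2 * C * s) ^ q) * ∫⁻ y in Metric.ball x (lam * s), g y ^ q ∂μ := by
  obtain ⟨hB0, hBt⟩ := hμ x s hs
  have hLt := (hμ x (lam * s) (by positivity)).2
  have hq0 : 0 < q := by linarith
  set m := ⨍ z in Metric.ball x s, f z ∂μ
  have hint : IntegrableOn (fun y => |f y - m|) (Metric.ball x s) μ :=
    (hf.integrableOn.sub (integrableOn_const hBt.ne)).abs
  have h1 := le_two_mul_lintegral_abs_sub m hA hD hAB hDB hfA hfD hMA hMD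
  have h2 : ENNReal.ofReal θ ≤ 2 * ENNReal.ofReal (⨍ y in Metric.ball x s, |f y - m| ∂μ) := by
    rw [ofReal_setAverage hint (Filter.Eventually.of_forall fun y => abs_nonneg _), ← mul_div_assoc,
      ENNReal.le_div_iff_mul_le (Or.inl hB0.ne') (Or.inl hBt.ne)]
    exact h1
  have h3 := h s hs f g hf hg
  have h4 : ENNReal.ofReal θ ≤ ENNReal.ofReal (2 * C * s) *
      (⨍⁻ y in Metric.ball x (lam * s), g y ^ q ∂μ) ^ (1 / q) := by
    refine h2.trans ((mul_le_mul_right h3 2).trans_eq ?_)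
    rw [← mul_assoc, ← ENNReal.ofReal_ofNat 2, ← ENNReal.ofReal_mul (by norm_num), mul_assoc]
  have h5 : ENNReal.ofReal (θ ^ q) ≤ ENNReal.ofReal ((2 * C * s) ^ q) *
      ⨍⁻ y in Metric.ball x (lam * s), g y ^ q ∂μ := by
    have := ENNReal.rpow_le_rpow h4 hq0.le
    rwa [ENNReal.mul_rpow_of_nonneg _ _ hq0.le, ← ENNReal.rpow_mul, one_div_mul_cancel hq0.ne',
      ENNReal.rpow_one, ENNReal.ofReal_rpow_of_pos hθ, ENNReal.ofReal_rpow_of_pos (by positivity)]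
      at this
  calc _ ≤ ENNReal.ofReal ((2 * C * s) ^ q) * (⨍⁻ y in Metric.ball x (lam * s), g y ^ q ∂μ) *
        μ (Metric.ball x (lam * s)) := by gcongr
    _ = _ := by rw [mul_assoc, mul_comm (⨍⁻ y in _, _ ∂μ), measure_mul_setLAverage _ hLt.ne]

end Oscillation

theorem ofReal_div_mul_le {a b : ℝ} (hb : 0 < b) {M E : ℝ≥0∞}
    (h : ENNReal.ofReal a * M ≤ ENNReal.ofReal b * E) : ENNReal.ofReal (a / b) * M ≤ E := by
  rw [ENNReal.ofReal_div_of_pos hb, ← ENNReal.mul_div_right_comm]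
  exact ENNReal.div_le_of_le_mul' h

/-! ### Consequences of doubling and reverse doubling; a covering argument. -/

section Doubling

variable {X : Type*} [MetricSpace X] [MeasurableSpace X] {μ : Measure X} {x : X} {C : ℝ}

theorem DoublingAt.measure_ball_le (h : DoublingAt μ x C) (hC : 0 < C) {k : ℕ} {t : ℝ}
    (ht : t ≤ 2 ^ k) {r : ℝ} (hr : 0 < r) :
    μ (Metric.ball x (t * r)) ≤ ENNReal.ofReal (C ^ k) * μ (Metric.ball x r) := by
  refine (measure_mono (Metric.ball_subset_ball (mul_le_mul_of_nonneg_right ht hr.le))).trans ?_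
  clear ht t
  induction k with
  | zero => simp
  | succ k ih =>
    calc μ (Metric.ball x (2 ^ (k + 1) * r)) = μ (Metric.ball x (2 * (2 ^ k * r))) := by ring_nf
      _ ≤ ENNReal.ofReal C * μ (Metric.ball x (2 ^ k * r)) := h _ (by positivity)
      _ ≤ ENNReal.ofReal C * (ENNReal.ofReal (C ^ k) * μ (Metric.ball x r)) := by gcongr
      _ = _ := by rw [← mul_assoc, ← ENNReal.ofReal_mul hC.le, pow_succ']

theorem DoublingAt.mul_measure_le {E F : Set X} (h : DoublingAt μ x C) (hC : 0 < C) {k : ℕ}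
    {s r : ℝ} (hr : 0 < r) (hsr : s ≤ 2 ^ k * r) (hF : F ⊆ Metric.ball x s)
    (hE : Metric.ball x r ⊆ E) : ENNReal.ofReal (1 / C ^ k) * μ F ≤ μ E := by
  refine ofReal_div_mul_le (by positivity) ?_
  rw [ENNReal.ofReal_one, one_mul]
  calc μ F ≤ μ (Metric.ball x (2 ^ k * r)) :=
        measure_mono (hF.trans (Metric.ball_subset_ball hsr))
    _ ≤ ENNReal.ofReal (C ^ k) * μ (Metric.ball x r) := h.measure_ball_le hC le_rfl hr
    _ ≤ _ := by gcongr

theorem ReverseDoublingAt.le_measure_diff {x₀ : X} {κ τ R : ℝ} (h : ReverseDoublingAt μ x₀ κ τ)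
    (hμ : ∀ (y : X) (r : ℝ), 0 < r → 0 < μ (Metric.ball y r) ∧ μ (Metric.ball y r) < ∞)
    (hκ : 1 < κ) (hR : 0 < R) (hdiam : ENNReal.ofReal (2 * τ * R) ≤ Metric.ediam (univ : Set X)) :
    ENNReal.ofReal (1 - 1 / κ) * μ (Metric.ball x₀ (τ * R)) ≤
      μ (Metric.ball x₀ (τ * R) \ Metric.ball x₀ R) := by
  have hκ0 : 0 < κ := by linarith
  have h2 : μ (Metric.ball x₀ R) ≤ ENNReal.ofReal (1 / κ) * μ (Metric.ball x₀ (τ * R)) := by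
    calc μ (Metric.ball x₀ R)
        = ENNReal.ofReal (1 / κ) * (ENNReal.ofReal κ * μ (Metric.ball x₀ R)) := by
          rw [← mul_assoc, ← ENNReal.ofReal_mul (by positivity), one_div_mul_cancel hκ0.ne',
            ENNReal.ofReal_one, one_mul]
      _ ≤ _ := by gcongr; exact h R hR hdiam
  rw [ENNReal.ofReal_sub _ (by positivity), ENNReal.ofReal_one,
    ENNReal.sub_mul fun _ _ => by
      -- `ENNReal.sub_mul` asks for finiteness. No sign of `τ` is assumed; if `τ * R ≤ 0` the ball
      -- is empty.
      by_cases h0 : μ (Metric.ball x₀ (τ * R)) = ∞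
      · exfalso
        rcases lt_or_ge 0 (τ * R) with ht | ht
        · exact (hμ x₀ _ ht).2.ne h0
        · simp [Metric.ball_eq_empty.2 ht] at h0
      · exact h0, one_mul]
  exact (tsub_le_tsub_left h2 _).trans le_measure_sdiff

variable [BorelSpace X]

/-- A set is covered by boundedly enlarged disjoint balls, so that a local lower bound for
integrals yields a global one. -/
theorem measure_le_of_forall_measure_ball_le
    (hμ : ∀ (y : X) (r : ℝ), 0 < r → 0 < μ (Metric.ball y r) ∧ μ (Metric.ball y r) < ∞)
    (hd : ∀ y, DoublingAt μ y C) (hC : 0 < C) {S : Set X} {x₀ : X} {R s : ℝ} (hs : 0 < s)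
    (hS : S ⊆ Metric.ball x₀ R) {K : ℝ≥0∞} {F : X → ℝ≥0∞}
    (h : ∀ y ∈ S, μ (Metric.ball y s) ≤ K * ∫⁻ z in Metric.ball y s, F z ∂μ) :
    μ S ≤ ENNReal.ofReal (C ^ 3) * K * ∫⁻ z, F z ∂μ := by
  -- Vitali with equal radii and enlargement factor 4. The closed ball of radius 4s lies in the open
  -- ball of radius 8s = 2³s, whence the factor `C ^ 3`.
  obtain ⟨u, huS, hdisj, hcov⟩ := Vitali.exists_disjoint_subfamily_covering_enlargement_closedBall
    S (id : X → X) (fun _ => s) s (fun _ _ => le_rfl) 4 (by norm_num)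
  have hdisj' : Pairwise (Function.onFun Disjoint fun y : u => Metric.ball (y : X) s) := by
    intro y z hyz
    exact (hdisj y.2 z.2 (fun hc => hyz (Subtype.ext hc))).mono Metric.ball_subset_closedBall
      Metric.ball_subset_closedBall
  have hcount : Countable u := by
    -- Disjoint balls of positive measure inside one ball of finite measure are countably many. The
    -- maximum with 1 keeps the radius positive whatever the sign of `R`.
    have hfin : μ (⋃ y : u, Metric.ball (y : X) s) ≠ ∞ := by
      refine ((measure_mono (iUnion_subset fun y => ?_)).trans_lt
        (hμ x₀ (max 1 (s + R)) (by positivity)).2).ne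
      refine Metric.ball_subset_ball' ?_
      have := Metric.mem_ball.1 (hS (huS y.2))
      exact le_trans (by linarith) (le_max_right _ _)
    have := Measure.countable_meas_pos_of_disjoint_of_meas_iUnion_ne_top μ
      (fun y : u => measurableSet_ball) hdisj' hfin
    rw [show {y : u | 0 < μ (Metric.ball (y : X) s)} = univ from
      eq_univ_of_forall fun y => (hμ y s hs).1] at this
    exact countable_univ_iff.1 this
  calc μ S ≤ μ (⋃ y : u, Metric.ball (y : X) (8 * s)) := by
        refine measure_mono fun z hz => ?_
        obtain ⟨b, hb, hsub⟩ := hcov z hz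
        refine mem_iUnion.2 ⟨⟨b, hb⟩, ?_⟩
        have := hsub (Metric.mem_closedBall_self hs.le)
        exact Metric.closedBall_subset_ball (by linarith) this
    _ ≤ ∑' y : u, μ (Metric.ball (y : X) (8 * s)) := measure_iUnion_le _
    _ ≤ ∑' y : u, ENNReal.ofReal (C ^ 3) * K * ∫⁻ z in Metric.ball (y : X) s, F z ∂μ := by
        refine ENNReal.tsum_le_tsum fun y => ?_
        rw [mul_assoc]
        exact ((hd y).measure_ball_le hC (by norm_num) hs).trans
          (mul_le_mul_right (h y (huS y.2)) _)
    _ = ENNReal.ofReal (C ^ 3) * K * ∫⁻ z in ⋃ y : u, Metric.ball (y : X) s, F z ∂μ := by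
        rw [ENNReal.tsum_mul_left, lintegral_iUnion (fun y : u => measurableSet_ball) hdisj']
    _ ≤ _ := by
        exact mul_le_mul_right (setLIntegral_le_lintegral _ _) _

end Doubling

/-! ### From weak upper gradients to upper gradients. -/

section WeakUpperGradients

/-- A curve may run inside a null set, so an a.e. equal Borel representative need not keep the upper
gradient inequalities. A majorant does; it is made infinite on a measurable null set containing the
bad points. -/
theorem _root_.AEMeasurable.exists_measurable_ge {X : Type*} [MeasurableSpace X] {μ : Measure X}
    {g : X → ℝ≥0∞} (hg : AEMeasurable g μ) :
    ∃ g' : X → ℝ≥0∞, Measurable g' ∧ g ≤ g' ∧ g =ᵐ[μ] g' := by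
  classical
  set N := toMeasurable μ {x | g x ≠ hg.mk g x}
  have hN : μ N = 0 := by
    rw [measure_toMeasurable]
    exact hg.ae_eq_mk
  refine ⟨N.piecewise (fun _ => ∞) (hg.mk g),
    measurable_const.piecewise (measurableSet_toMeasurable _ _) hg.measurable_mk, fun x => ?_, ?_⟩
  · by_cases hx : x ∈ N
    · simp [hx]
    · rw [piecewise_eq_of_notMem _ _ _ hx]
      by_contra hc
      exact hx (subset_toMeasurable _ _ fun he => hc he.le)
  · filter_upwards [measure_eq_zero_iff_ae_notMem.1 hN] with x hx
    rw [piecewise_eq_of_notMem _ _ _ hx]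
    by_contra hc
    exact hx (subset_toMeasurable _ _ hc)

theorem integrable_of_le_one_of_eq_zero {X : Type*} [MeasurableSpace X]
    {μ : Measure X} {f : X → ℝ} {Ω : Set X} (hf : AEMeasurable f μ) (hΩ : MeasurableSet Ω)
    (hΩt : μ Ω ≠ ∞) (h0 : ∀ x ∈ Ω, 0 ≤ f x) (h1 : ∀ x ∈ Ω, f x ≤ 1)
    (hz : ∀ x ∉ Ω, f x = 0) : Integrable f μ := by
  refine Integrable.mono' (g := Ω.indicator fun _ => (1 : ℝ))
    ((integrable_indicator_iff hΩ).2 (integrableOn_const hΩt)) hf.aestronglyMeasurable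
    (Filter.Eventually.of_forall fun x => ?_)
  by_cases hx : x ∈ Ω
  · rw [indicator_of_mem hx, Real.norm_eq_abs, abs_of_nonneg (h0 x hx)]
    exact h1 x hx
  · simp [hz x hx, hx]

variable {X : Type*} [MetricSpace X] [MeasurableSpace X] [BorelSpace X] {μ : Measure X}

/-- The energy in `Ω` of a weak upper gradient of a function vanishing off the open set `Ω` is
approximated by the total energy of upper gradients. -/
theorem IsWeakUpperGradient.exists_isUpperGradient {p : ℝ} (hp : 0 < p) {u : X → ℝ}
    {g : X → ℝ≥0∞} (hg : IsWeakUpperGradient p μ u g) {Ω : Set X} (hΩ : IsOpen Ω)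
    (hu : ∀ x ∉ Ω, u x = 0) {ε : ℝ≥0∞} (hε : ε ≠ 0) :
    ∃ h : X → ℝ≥0∞, IsUpperGradient u h ∧
      ∫⁻ x, h x ^ p ∂μ ≤ ∫⁻ x in Ω, g x ^ p ∂μ + ε := by
  obtain ⟨hgm, ρ, hρ, hρp, hρΓ⟩ := hg
  obtain ⟨g', hg'm, hle, hae⟩ := hgm.exists_measurable_ge
  set I := ∫⁻ x, ρ x ^ p ∂μ with hI
  -- Chosen so that `t ^ p * I ≤ ε` with `t ≠ 0`; the `+ 1` covers `I = 0`.
  set t : ℝ≥0∞ := (ε / (I + 1)) ^ (1 / p)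
  have hI1 : I + 1 ≠ ∞ := ENNReal.add_ne_top.2 ⟨hρp.ne, ENNReal.one_ne_top⟩
  have ht0 : t ≠ 0 := by
    rw [Ne, ENNReal.rpow_eq_zero_iff_of_pos (by positivity), ENNReal.div_eq_zero_iff]
    exact not_or.2 ⟨hε, hI1⟩
  have htp : t ^ p * I ≤ ε := by
    rw [← ENNReal.rpow_mul, one_div_mul_cancel hp.ne', ENNReal.rpow_one]
    calc ε / (I + 1) * I ≤ ε / (I + 1) * (I + 1) := by gcongr; exact le_self_add
      _ = ε := ENNReal.div_mul_cancel (by simp) hI1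
  -- Where `ρ` has infinite line integral, `t * ρ` makes the inequality trivial. Any other curve has
  -- no exceptional subcurve, so `g'` may be cut down to `Ω`.
  refine ⟨fun x => max (Ω.indicator g' x) (t * ρ x),
    ⟨(hg'm.indicator hΩ.measurableSet).max (hρ.const_mul t), fun γ => ?_⟩, ?_⟩
  · by_cases hγ : lineIntegral γ ρ = ∞
    · have : lineIntegral γ (fun x => max (Ω.indicator g' x) (t * ρ x)) = ∞ := by
        refine top_le_iff.1 ?_
        calc ∞ = t * lineIntegral γ ρ := by rw [hγ, ENNReal.mul_top ht0]
          _ ≤ ∫⁻ s in Icc 0 γ.len, t * ρ (γ.toFun s) := lintegral_const_mul_le _ _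
          _ ≤ _ := lintegral_mono fun s => le_max_right _ _
      rw [UpperGradientIneq, this]
      exact le_top
    · refine (UpperGradientIneq.indicator (g := g') hΩ hu γ fun a b ha hab hb => ?_).trans
        (lintegral_mono fun s => le_max_left _ _)
      have hug : UpperGradientIneq u g (γ.sub a b ha hab hb) := by
        by_contra hc
        exact hγ (top_le_iff.1 ((hρΓ _ hc).symm.trans_le (γ.lineIntegral_sub_le ha hab hb ρ)))
      exact hug.trans (lintegral_mono fun s => hle _)
  · have hpt : ∀ x, max (Ω.indicator g' x) (t * ρ x) ^ p ≤
        Ω.indicator (fun y => g' y ^ p) x + t ^ p * ρ x ^ p := by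
      intro x
      have h1 : Ω.indicator (fun y => g' y ^ p) x = Ω.indicator g' x ^ p := by
        by_cases hx : x ∈ Ω <;> simp [hx, hp]
      rw [h1, ← ENNReal.mul_rpow_of_nonneg _ _ hp.le]
      rcases le_total (Ω.indicator g' x) (t * ρ x) with h | h
      · rw [max_eq_right h]; exact le_add_self
      · rw [max_eq_left h]; exact le_self_add
    calc ∫⁻ x, max (Ω.indicator g' x) (t * ρ x) ^ p ∂μ
        ≤ ∫⁻ x, Ω.indicator (fun y => g' y ^ p) x + t ^ p * ρ x ^ p ∂μ := lintegral_mono hpt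
      _ = ∫⁻ x in Ω, g' x ^ p ∂μ + t ^ p * I := by
        rw [lintegral_add_right _ ((hρ.pow_const p).const_mul _),
          lintegral_indicator hΩ.measurableSet, lintegral_const_mul _ (hρ.pow_const p)]
      _ ≤ ∫⁻ x in Ω, g x ^ p ∂μ + ε := by
        refine add_le_add (le_of_eq (lintegral_congr_ae (ae_restrict_of_ae ?_))) htp
        filter_upwards [hae] with x hx
        rw [hx]

end WeakUpperGradients

/-! ### Measure of annuli, and energy of functions that drop from 1 to 0 across them. -/

section Annuli

variable {X : Type*} [MetricSpace X] [MeasurableSpace X] [BorelSpace X] {μ : Measure X} {x₀ : X}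

theorem integrable_cutoff
    (hμ : ∀ (y : X) (r : ℝ), 0 < r → 0 < μ (Metric.ball y r) ∧ μ (Metric.ball y r) < ∞)
    {r R : ℝ} (hR : 0 < R) (hrR : r < R) : Integrable (cutoff x₀ r R) μ :=
  integrable_of_le_one_of_eq_zero (cutoff_lipschitzWith x₀ hrR).continuous.aemeasurable
    measurableSet_ball (hμ x₀ R hR).2.ne (fun _ _ => cutoff_nonneg _ _ _ _)
    (fun _ _ => cutoff_le_one _ _ _ _) fun _ hx => cutoff_eq_zero hrR hx

/-- Lower bound for the measure of a thin annulus. -/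
theorem PoincareAt.le_measure_annulus {q C lam CD η τ : ℝ} {k : ℕ} (h : PoincareAt q μ x₀ C lam)
    (hμ : ∀ (y : X) (r : ℝ), 0 < r → 0 < μ (Metric.ball y r) ∧ μ (Metric.ball y r) < ∞)
    (hd : DoublingAt μ x₀ CD) (hq : 1 ≤ q) (hlam : 1 ≤ lam) (hC : 0 < C) (hCD : 0 < CD)
    (hη : 0 < η) (hτ : 1 < τ) (hk : 2 * τ ≤ 2 ^ k) {r R : ℝ} (hR : 0 < R / 2) (hr : R / 2 ≤ r)
    (hrR : r < R)
    (hrev : ENNReal.ofReal η * μ (Metric.ball x₀ (τ * R)) ≤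
      μ (Metric.ball x₀ (τ * R) \ Metric.ball x₀ R)) :
    ENNReal.ofReal ((min η (1 / CD ^ k) / (2 * C * τ)) ^ q * (1 - r / R) ^ q) *
      μ (Metric.ball x₀ R) ≤ μ (Metric.ball x₀ R \ Metric.ball x₀ r) := by
  have hR0 : 0 < R := by linarith
  have hτ0 : 0 < τ := by linarith
  have hτR : R ≤ τ * R := le_mul_of_one_le_left hR0.le hτ.le
  have hq0 : 0 < q := by linarith
  have hδ : 0 < R - r := sub_pos.2 hrR
  -- `k` counts doublings from R/2 to τR: as R/2 ≤ r, the ball B(x₀, r) fills at least the fraction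
  -- `1 / CD ^ k` of B(x₀, τR).
  set θ := min η (1 / CD ^ k)
  have hθ : 0 < θ := lt_min hη (by positivity)
  have key := h.measure_ball_mul_le hμ hq hlam hC (s := τ * R) (by positivity) hθ
    (integrable_cutoff hμ hR0 hrR) (isUpperGradient_cutoff x₀ hrR)
    (A := Metric.ball x₀ r) (D := Metric.ball x₀ (τ * R) \ Metric.ball x₀ R)
    measurableSet_ball (measurableSet_ball.diff measurableSet_ball)
    (Metric.ball_subset_ball (hrR.le.trans hτR)) sdiff_subset
    (fun y hy => cutoff_eq_one hrR hy) (fun y hy => cutoff_eq_zero hrR hy.2)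
    (le_trans (by gcongr; exact min_le_right _ _)
      (hd.mul_measure_le hCD hR (s := τ * R) (k := k) (by nlinarith) Subset.rfl
        (Metric.ball_subset_ball hr)))
    (le_trans (by gcongr; exact min_le_left _ _) hrev)
  have hint : ∫⁻ y in Metric.ball x₀ (lam * (τ * R)),
      ((Metric.ball x₀ R \ Metric.ball x₀ r).indicator
        (fun _ => ENNReal.ofReal (1 / (R - r))) y) ^ q ∂μ ≤
      ENNReal.ofReal ((1 / (R - r)) ^ q) * μ (Metric.ball x₀ R \ Metric.ball x₀ r) := by
    refine (setLIntegral_le_lintegral _ _).trans ?_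
    rw [← ENNReal.ofReal_rpow_of_pos (by positivity),
      ← lintegral_indicator_const (measurableSet_ball.diff measurableSet_ball)]
    refine lintegral_mono fun y => ?_
    by_cases hy : y ∈ Metric.ball x₀ R \ Metric.ball x₀ r
    · simp only [indicator_of_mem hy]; exact le_rfl
    · simp only [indicator_of_notMem hy, ENNReal.zero_rpow_of_pos hq0]; exact le_rfl
  have key2 : ENNReal.ofReal (θ ^ q) * μ (Metric.ball x₀ R) ≤
      ENNReal.ofReal ((2 * C * (τ * R)) ^ q * (1 / (R - r)) ^ q) *
        μ (Metric.ball x₀ R \ Metric.ball x₀ r) := by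
    rw [ENNReal.ofReal_mul (by positivity), mul_assoc]
    refine le_trans ?_ (key.trans (mul_le_mul_right hint _))
    gcongr
    exact hτR.trans (le_mul_of_one_le_left (by positivity) hlam)
  have hw : 0 < 1 - r / R := by rw [sub_pos, div_lt_one hR0]; exact hrR
  convert ofReal_div_mul_le (by positivity) key2 using 3
  rw [← Real.mul_rpow (by positivity) hw.le, ← Real.mul_rpow (by positivity) (by positivity),
    ← Real.div_rpow hθ.le (by positivity)]
  congr 1
  field_simp

/-- A Poincaré inequality at `x₀` prevents empty annuli around `x₀`. -/
theorem PoincareAt.exists_mem_annulus {q C lam : ℝ} (h : PoincareAt q μ x₀ C lam)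
    (hμ : ∀ (y : X) (r : ℝ), 0 < r → 0 < μ (Metric.ball y r) ∧ μ (Metric.ball y r) < ∞)
    (hq : 1 ≤ q) (hlam : 1 ≤ lam) (hC : 0 < C) {r R : ℝ} (hr : 0 < r) (hrR : r < R) {y : X}
    (hy : R < dist y x₀) : (Metric.ball x₀ R \ Metric.ball x₀ r).Nonempty := by
  by_contra hne
  rw [not_nonempty_iff_eq_empty] at hne
  -- If the annulus is empty, zero is an upper gradient of the cutoff, although the cutoff is 1 near
  -- `x₀` and 0 near `y`.
  have hug := isUpperGradient_cutoff x₀ hrR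
  rw [hne, indicator_empty] at hug
  have hε : 0 < dist y x₀ - R := sub_pos.2 hy
  set s := dist y x₀ + (dist y x₀ - R)
  have hs : 0 < s := by positivity
  have hBt := (hμ x₀ s hs).2.ne
  have hB0 := (hμ x₀ s hs).1.ne'
  -- Only positivity of the relative measure matters here, so doubling is not needed.
  set m := min (μ (Metric.ball x₀ r)) (μ (Metric.ball y (dist y x₀ - R)))
  have hm0 : 0 < m := lt_min (hμ _ _ hr).1 (hμ _ _ hε).1
  have hmt : m ≠ ∞ := (min_le_left _ _).trans_lt (hμ _ _ hr).2 |>.ne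
  have hmB : m / μ (Metric.ball x₀ s) ≠ ∞ := ENNReal.div_ne_top hmt hB0
  have hθ : 0 < (m / μ (Metric.ball x₀ s)).toReal :=
    ENNReal.toReal_pos (ENNReal.div_pos hm0.ne' hBt).ne' hmB
  have hθm : ENNReal.ofReal (m / μ (Metric.ball x₀ s)).toReal * μ (Metric.ball x₀ s) = m := by
    rw [ENNReal.ofReal_toReal hmB, ENNReal.div_mul_cancel hB0 hBt]
  have key := h.measure_ball_mul_le hμ hq hlam hC hs hθ
    (integrable_cutoff hμ (hr.trans hrR) hrR) hug
    (A := Metric.ball x₀ r) (D := Metric.ball y (dist y x₀ - R))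
    measurableSet_ball measurableSet_ball
    (Metric.ball_subset_ball (by simp only [s]; linarith))
    (Metric.ball_subset_ball' (by simp only [s]; linarith))
    (fun z hz => cutoff_eq_one hrR hz) (fun z hz => cutoff_eq_zero hrR fun hz' => by
      have h1 := dist_triangle_left y x₀ z
      rw [Metric.mem_ball] at hz hz'
      linarith)
    (hθm.trans_le (min_le_left _ _)) (hθm.trans_le (min_le_right _ _))
  simp only [ENNReal.zero_rpow_of_pos (show 0 < q by linarith), lintegral_zero, mul_zero] at key
  refine absurd key (not_le.2 (ENNReal.mul_pos (ENNReal.ofReal_pos.2 (by positivity)).ne' ?_))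
  exact (hμ x₀ _ (by positivity)).1.ne'

/-- Stands in for reverse doubling. Split the shell between R and τR into three layers of width σR.
The middle one contains a point z since annuli are nonempty, so B(z, σR) lies in the shell, and
doubling at z compares it with B(z, 2τR), which contains B(x₀, τR). -/
theorem PoincareAt.le_measure_diff {q C lam CD τ R : ℝ} {k : ℕ} (h : PoincareAt q μ x₀ C lam)
    (hμ : ∀ (y : X) (r : ℝ), 0 < r → 0 < μ (Metric.ball y r) ∧ μ (Metric.ball y r) < ∞)
    (hd : ∀ y, DoublingAt μ y CD) (hq : 1 ≤ q) (hlam : 1 ≤ lam) (hC : 0 < C) (hCD : 0 < CD)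
    (hτ : 1 < τ) (hk : 2 * τ ≤ 2 ^ k * ((τ - 1) / 3)) (hR : 0 < R)
    (hdiam : ENNReal.ofReal (2 * τ * R) < Metric.ediam (univ : Set X)) :
    ENNReal.ofReal (1 / CD ^ k) * μ (Metric.ball x₀ (τ * R)) ≤
      μ (Metric.ball x₀ (τ * R) \ Metric.ball x₀ R) := by
  set σ := (τ - 1) / 3
  have hσ : 0 < σ := by simp only [σ]; linarith
  have hτσ : τ = 1 + 3 * σ := by simp only [σ]; ring
  have hσR : 0 < σ * R := by positivity
  -- Otherwise the diameter of X would be at most 2τR.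
  obtain ⟨y, hy⟩ : ∃ y, τ * R < dist y x₀ := by
    by_contra! hc
    refine absurd (Metric.ediam_le fun y _ z _ => ?_) (not_le.2 hdiam)
    rw [edist_dist]
    refine ENNReal.ofReal_le_ofReal ?_
    linarith [dist_triangle_right y z x₀, hc y, hc z]
  obtain ⟨z, hz, hz'⟩ := h.exists_mem_annulus hμ hq hlam hC (r := R + σ * R)
    (R := R + 2 * (σ * R)) (by positivity) (by linarith) (y := y)
    (by rw [hτσ] at hy; linarith)
  rw [Metric.mem_ball] at hz
  rw [Metric.mem_ball, not_lt] at hz'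
  refine (hd z).mul_measure_le hCD hσR (s := 2 * τ * R) (by nlinarith)
    (Metric.ball_subset_ball' ?_) fun w hw => ⟨?_, fun hw' => ?_⟩
  · rw [dist_comm, hτσ]; nlinarith
  · rw [Metric.mem_ball] at hw ⊢
    rw [hτσ]
    linarith [dist_triangle w z x₀]
  · rw [Metric.mem_ball] at hw hw'
    linarith [dist_triangle_left z x₀ w]

/-- An upper gradient of a function that is `1` on `B(x₀, r)` and `0` off `B(x₀, R)` has large
energy if the geometric condition on the annulus holds. -/
theorem measure_annulus_le {p CP lam CD a r R : ℝ} {k : ℕ}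
    (hμ : ∀ (y : X) (r : ℝ), 0 < r → 0 < μ (Metric.ball y r) ∧ μ (Metric.ball y r) < ∞)
    (hd : ∀ y, DoublingAt μ y CD) (h : ∀ y, PoincareAt p μ y CP lam) (hp : 1 ≤ p)
    (hlam : 1 ≤ lam) (hCP : 0 < CP) (hCD : 0 < CD) (ha : 0 < a) (hk : 4 ≤ 2 ^ k * a)
    (hrR : r < R) (hann : AnnulusCondition x₀ a r R) {u : X → ℝ} {g : X → ℝ≥0∞}
    (hu : Integrable u μ) (hg : IsUpperGradient u g) (hu1 : ∀ y ∈ Metric.ball x₀ r, u y = 1)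
    (hu0 : ∀ y ∉ Metric.ball x₀ R, u y = 0) :
    μ (Metric.ball x₀ R \ Metric.ball x₀ r) ≤
      ENNReal.ofReal (CD ^ 3 * ((2 * CP * (2 * (R - r))) ^ p / (1 / CD ^ k) ^ p)) *
        ∫⁻ x, g x ^ p ∂μ := by
  have hδ : 0 < R - r := sub_pos.2 hrR
  rw [ENNReal.ofReal_mul (by positivity)]
  -- The covering uses the dilated radius 2λδ: the local estimate has the dilated ball on both
  -- sides, so λ does not enter the constant.
  refine measure_le_of_forall_measure_ball_le hμ hd hCD (s := lam * (2 * (R - r)))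
    (by positivity) (sdiff_subset : _ ⊆ Metric.ball x₀ R) fun x hx => ?_
  obtain ⟨x', x'', hx', hx''⟩ := hann x hx
  have haδ : 0 < a * (R - r) := by positivity
  have hball : ∀ z, Metric.ball z (a * (R - r)) ⊆ Metric.ball x (2 * (R - r)) →
      ENNReal.ofReal (1 / CD ^ k) * μ (Metric.ball x (2 * (R - r))) ≤
        μ (Metric.ball z (a * (R - r))) := by
    intro z hz
    -- The centre z is within 2δ of x, so B(x, 2δ) ⊆ B(z, 4δ), and `k` doublings lead from aδ to at
    -- least 4δ.
    refine (hd z).mul_measure_le hCD haδ (s := 4 * (R - r)) (by nlinarith)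
      (Metric.ball_subset_ball' ?_) Subset.rfl
    have := Metric.mem_ball'.1 (hz (Metric.mem_ball_self haδ))
    linarith
  have key := (h x).measure_ball_mul_le hμ hp hlam hCP (s := 2 * (R - r)) (by positivity)
    (θ := 1 / CD ^ k) (by positivity) hu hg measurableSet_ball measurableSet_ball
    (fun y hy => (hx' hy).1) (fun y hy => (hx'' hy).1) (fun y hy => hu1 y (hx' hy).2)
    (fun y hy => hu0 y (hx'' hy).2) (hball x' fun y hy => (hx' hy).1)
    (hball x'' fun y hy => (hx'' hy).1)
  have hθ : 0 < (1 / CD ^ k) ^ p := by positivity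
  rw [div_eq_inv_mul, ENNReal.ofReal_mul (by positivity), mul_assoc, ENNReal.ofReal_inv_of_pos hθ,
    ← ENNReal.div_eq_inv_mul,
    ENNReal.le_div_iff_mul_le (Or.inl (ENNReal.ofReal_pos.2 hθ).ne') (Or.inl ENNReal.ofReal_ne_top),
    mul_comm]
  exact key

end Annuli

end AnnularCap

/-! ### Choice of constants and conclusion. -/

open AnnularCap in
theorem mainTheorem7 :
    -- the corollary: lower bound for the capacity of thin annuli
    (∀ p q CD CP lamP Cq lamq a τ : ℝ, 1 ≤ q → q < p → 0 < CD → 0 < CP → 1 ≤ lamP → 0 < Cq →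
      1 ≤ lamq → 0 < a → 1 < τ →
      ∃ c : ℝ, 0 < c ∧
        ∀ (X : Type*) [MetricSpace X] [MeasurableSpace X] [BorelSpace X] (μ : Measure X) (x₀ : X),
          (∀ (x : X) (r : ℝ), 0 < r → 0 < μ (Metric.ball x r) ∧ μ (Metric.ball x r) < ∞) →
          (∀ x : X, DoublingAt μ x CD) →
          (∀ x : X, PoincareAt p μ x CP lamP) →
          PoincareAt q μ x₀ Cq lamq →
          ∀ r R : ℝ, 0 < R / 2 → R / 2 ≤ r → r < R →
            ENNReal.ofReal (2 * τ * R) < Metric.ediam (univ : Set X) →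
            AnnulusCondition x₀ a r R →
            ENNReal.ofReal (c * (1 - r / R) ^ (q - p) / R ^ p) * μ (Metric.ball x₀ R) ≤
              variationalCapacity p μ (Metric.ball x₀ r) (Metric.ball x₀ R)) ∧
    -- the lemma: lower bound for the measure of thin annuli
    (∀ q CD Cq lamq κ τ : ℝ, 1 ≤ q → 0 < CD → 0 < Cq → 1 ≤ lamq → 1 < κ → 1 < τ →
      ∃ c : ℝ, 0 < c ∧
        ∀ (X : Type*) [MetricSpace X] [MeasurableSpace X] [BorelSpace X] (μ : Measure X) (x₀ : X),
          (∀ (x : X) (r : ℝ), 0 < r → 0 < μ (Metric.ball x r) ∧ μ (Metric.ball x r) < ∞) →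
          DoublingAt μ x₀ CD →
          ReverseDoublingAt μ x₀ κ τ →
          PoincareAt q μ x₀ Cq lamq →
          ∀ r R : ℝ, 0 < R / 2 → R / 2 ≤ r → r < R →
            ENNReal.ofReal (2 * τ * R) < Metric.ediam (univ : Set X) →
            ENNReal.ofReal (c * (1 - r / R) ^ q) * μ (Metric.ball x₀ R) ≤
              μ (Metric.ball x₀ R \ Metric.ball x₀ r)) := by
  constructor
  · intro p q CD CP lamP Cq lamq a τ hq hqp hCD hCP hlamP hCq hlamq ha hτ
    have hτ0 : 0 < τ := by linarith
    have hp : 1 ≤ p := by linarith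
    -- Numbers of doublings: `k₁` from (τ - 1)R/3 to 2τR, `k₂` from R/2 to τR, `k₃` from aδ to 4δ.
    obtain ⟨k₁, hk₁⟩ := pow_unbounded_of_one_lt (2 * τ / ((τ - 1) / 3)) one_lt_two
    obtain ⟨k₂, hk₂⟩ := pow_unbounded_of_one_lt (2 * τ) one_lt_two
    obtain ⟨k₃, hk₃⟩ := pow_unbounded_of_one_lt (4 / a) one_lt_two
    have hk₁' := ((div_lt_iff₀ (by linarith)).1 hk₁).le
    have hk₃' := ((div_lt_iff₀ ha).1 hk₃).le
    set c₁ := (min (1 / CD ^ k₁) (1 / CD ^ k₂) / (2 * Cq * τ)) ^ q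
    have hc₁ : 0 < c₁ := by
      have : 0 < min (1 / CD ^ k₁) (1 / CD ^ k₂) := lt_min (by positivity) (by positivity)
      positivity
    -- Quotient of the constants in the annulus bound and the energy bound. Writing δ = R(1 - r/R),
    -- the factor `(2 * CP * (2 * δ)) ^ p` leaves `(4 * CP) ^ p` here and supplies `R ^ p` and the
    -- `- p` in the exponent.
    refine ⟨c₁ / (CD ^ 3 * ((4 * CP) ^ p / (1 / CD ^ k₃) ^ p)), by positivity, ?_⟩
    intro X _ _ _ μ x₀ hμ hd hP hPq r R hR hr hrR hdiam hann
    have hR0 : 0 < R := by linarith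
    refine le_iInf₂ fun u hu => le_iInf₂ fun g hg => ?_
    obtain ⟨⟨hum, -⟩, hu01, hu0⟩ := hu
    refine ENNReal.le_of_forall_pos_le_add fun ε hε _ => ?_
    obtain ⟨h, hh, hle⟩ := hg.1.exists_isUpperGradient (by linarith) Metric.isOpen_ball hu0
      (ENNReal.coe_pos.2 hε).ne'
    refine le_trans ?_ hle
    have hui : Integrable u μ := integrable_of_le_one_of_eq_zero hum measurableSet_ball
      (hμ x₀ R hR0).2.ne
      (fun x hx => (indicator_nonneg (fun _ _ => zero_le_one) x).trans (hu01 x hx).1)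
      (fun x hx => (hu01 x hx).2) hu0
    have hu1 : ∀ y ∈ Metric.ball x₀ r, u y = 1 := fun y hy => by
      have := hu01 y (Metric.ball_subset_ball hrR.le hy)
      rw [indicator_of_mem hy] at this
      exact le_antisymm this.2 this.1
    have h1 : ENNReal.ofReal (c₁ * (1 - r / R) ^ q) * μ (Metric.ball x₀ R) ≤ _ :=
      hPq.le_measure_annulus hμ (hd x₀) hq hlamq hCq hCD (by positivity) hτ hk₂.le hR hr
        hrR (hPq.le_measure_diff hμ hd hq hlamq hCq hCD hτ hk₁' hR0 hdiam)
    have h2 := measure_annulus_le hμ hd hP hp hlamP hCP hCD ha hk₃' hrR hann hui hh hu1 hu0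
    have hδ : 0 < R - r := sub_pos.2 hrR
    refine le_of_eq_of_le ?_ (ofReal_div_mul_le (by positivity) (h1.trans h2))
    congr 2
    have hw : 0 < 1 - r / R := by rw [sub_pos, div_lt_one hR0]; exact hrR
    have hδw : 2 * CP * (2 * (R - r)) = 4 * CP * R * (1 - r / R) := by field_simp; ring
    rw [hδw, Real.mul_rpow (by positivity) hw.le, Real.mul_rpow (by positivity) hR0.le,
      Real.rpow_sub hw]
    have := Real.rpow_pos_of_pos hw p
    have := Real.rpow_pos_of_pos hR0 p
    field_simp
  · intro q CD Cq lamq κ τ hq hCD hCq hlamq hκ hτ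
    obtain ⟨k, hk⟩ := pow_unbounded_of_one_lt (2 * τ) one_lt_two
    have hη : 0 < 1 - 1 / κ := by rw [sub_pos, div_lt_one (by linarith)]; exact hκ
    refine ⟨(min (1 - 1 / κ) (1 / CD ^ k) / (2 * Cq * τ)) ^ q, ?_, ?_⟩
    · have : 0 < min (1 - 1 / κ) (1 / CD ^ k) := lt_min hη (by positivity)
      positivity
    · intro X _ _ _ μ x₀ hμ hd hrev hPq r R hR hr hrR hdiam
      exact hPq.le_measure_annulus hμ hd hq hlamq hCq hCD hη hτ hk.le hR hr hrR
        (hrev.le_measure_diff hμ hκ (by linarith) hdiam.le)
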